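/- Fix a real number $\xi \ge 0$, and let $(a_n)_{n\ge 0}$ be a sequence of real numbers. Then the following are equivalent: (a) $(a_n)$ is a $\xi$-Stieltjes moment sequence, i.e. there exists a positive measure $\mu$ on $\mathbb{R}$, with support in $[\xi,\infty)$, such that $a_n = \int x^n \, d\mu(x)$ for all $n \ge 0$ (in particular all these integrals converge absolutely). (b) There exist real numbers $c \ge 0$, $g_0 = 0$ and $g_1, g_2, \ldots \ge 0$ such that, in the sense of formal power series in $t$, $$\sum_{n=0}^\infty a_n t^n \;=\; \cfrac{c}{1 - \cfrac{\alpha_1 t}{1 - \cfrac{\alpha_2 t}{1 - \cdots}}}$$ (the finite truncations of the continued fraction converge coefficientwise to the left-hand side), where for all $k \ge 1$ $$\alpha_{2k-1} \;=\; \xi\,(1+g_{2k-2}) + g_{2k-1}, \qquad \alpha_{2k} \;=\; \frac{g_{2k-1}\, g_{2k}}{1+g_{2k-2}}.$$ (c) Same as (b), but with $g_0 \ge 0$ in place of $g_0 = 0$. -/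

import Mathlib

open PowerSeries MeasureTheory

noncomputable section

/-- `a` is a `ξ`-Stieltjes moment sequence: there is a positive Borel measure `μ` with support
in `[ξ, ∞)`, having finite moments of all orders, such that `a n = ∫ x ^ n dμ(x)` for all `n`. -/
def IsXiStieltjes (ξ : ℝ) (a : ℕ → ℝ) : Prop :=
  ∃ μ : Measure ℝ, μ.support ⊆ Set.Ici ξ ∧
    ∀ n : ℕ, Integrable (fun x : ℝ => x ^ n) μ ∧ a n = ∫ x, x ^ n ∂μ

/-- The finite continued fraction `1 / (1 - α i t / (1 - α (i+1) t / ⋯ / (1 - α (i+n-1) t)))`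
with `n` coefficients, starting at the index `i`, as a formal power series. Every denominator has
constant term `1`, so that `⁻¹` is the inverse of an invertible power series. -/
def sFracConvergent (α : ℕ → ℝ) : ℕ → ℕ → ℝ⟦X⟧
  | 0, _ => 1
  | n + 1, i => (1 - PowerSeries.C (α i) * PowerSeries.X * sFracConvergent α n (i + 1))⁻¹

/-- `f(t) = c / (1 - α 1 t / (1 - α 2 t / (1 - ⋯)))` in the sense of formal power series: the
finite truncations of the continued fraction converge to `f` coefficientwise, that is, each
coefficient is eventually equal to that of `f`. The value `α 0` plays no role. -/
def IsSFraction (f : ℝ⟦X⟧) (c : ℝ) (α : ℕ → ℝ) : Prop :=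
  ∀ m : ℕ, ∀ᶠ n in Filter.atTop,
    PowerSeries.coeff m (PowerSeries.C c * sFracConvergent α n 1) = PowerSeries.coeff m f

/-- The relations `α_{2k-1} = ξ (1 + g_{2k-2}) + g_{2k-1}` and
`α_{2k} = g_{2k-1} g_{2k} / (1 + g_{2k-2})` for all `k ≥ 1` (with `k + 1` written for `k`). -/
def XiCoefficients (ξ : ℝ) (g α : ℕ → ℝ) : Prop :=
  ∀ k : ℕ, α (2 * k + 1) = ξ * (1 + g (2 * k)) + g (2 * k + 1) ∧
    α (2 * k + 2) = g (2 * k + 1) * g (2 * k + 2) / (1 + g (2 * k))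

end

/-! The case ξ = 0 is Stieltjes' theorem, and the general case is reduced to it by translating the
measure. On generating functions translation is the binomial transform `xiShift`. An S-fraction does
not behave simply under it, but the even contraction of the S-fraction does: every diagonal
coefficient of the resulting J-fraction grows by ξ and the off-diagonal ones stay fixed. With g₀ =
0, the α built from g contract to the ξ-shift of β_{2k+1} = g_{2k+1}, β_{2k+2} = α_{2k+1} g_{2k+2} /
(1 + g_{2k}) (`IsSTailFamily.eq_xiShift_of_xiCoefficients`).

Stieltjes' theorem is proved in both directions. From a measure: the Hankel forms are positive
semidefinite, and this positivity survives peeling off one layer of the fraction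
(`IsHankelPos.of_inv`), so all coefficients are nonnegative. From nonnegative coefficients: each
convergent is a moment series of a vector for a Gram matrix, hence of a finite atomic measure on [0,
∞) (`exists_measure_sFracConvergent`); tightness gives a limit measure
(`exists_measure_of_moments_eventually_eq`).

It remains to pass between coefficients: `exists_xiCoefficients_of_nonneg` recovers g from β, and
`XiCoefficients.exists_zero_start` replaces g₀ ≥ 0 by g₀ = 0 without changing α. -/

/-! ### Formal S-fractions and convergence of their truncations -/

/-- `F i` is the infinite continued fraction `1 / (1 - α i t / (1 - α (i+1) t / ⋯))`. -/
def IsSTailFamily (α : ℕ → ℝ) (F : ℕ → ℝ⟦X⟧) : Prop :=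
  ∀ i, F i * (1 - C (α i) * X * F (i + 1)) = 1

lemma sFracConvergent_succ_mul (α : ℕ → ℝ) (n i : ℕ) :
    sFracConvergent α (n + 1) i * (1 - C (α i) * X * sFracConvergent α n (i + 1)) = 1 := by
  rw [sFracConvergent]
  exact PowerSeries.inv_mul_cancel _ (by simp)

/-- Subtracting the two equations gives f - f' = c X f f' (p - p'), so each layer of the fraction
gains one order of X-adic agreement. -/
lemma X_pow_succ_dvd_sub_of_mul_eq_one {f f' p p' : ℝ⟦X⟧} {c : ℝ} {n : ℕ}
    (hf : f * (1 - C c * X * p) = 1) (hf' : f' * (1 - C c * X * p') = 1)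
    (h : (X : ℝ⟦X⟧) ^ n ∣ p - p') : (X : ℝ⟦X⟧) ^ (n + 1) ∣ f - f' := by
  obtain ⟨q, hq⟩ := h
  refine ⟨C c * q * f * f', ?_⟩
  linear_combination f' * hf - f * hf' + f * f' * C c * X * hq

lemma X_pow_dvd_sFracConvergent_succ_sub (α : ℕ → ℝ) (n i : ℕ) :
    (X : ℝ⟦X⟧) ^ (n + 1) ∣ sFracConvergent α (n + 1) i - sFracConvergent α n i := by
  induction n generalizing i with
  | zero =>
    refine ⟨C (α i) * sFracConvergent α 1 i, ?_⟩
    have h := sFracConvergent_succ_mul α 0 i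
    simp only [sFracConvergent.eq_1, zero_add, pow_one] at h ⊢
    linear_combination h
  | succ n ih =>
    exact X_pow_succ_dvd_sub_of_mul_eq_one (sFracConvergent_succ_mul α _ i)
      (sFracConvergent_succ_mul α _ i) (ih (i + 1))

lemma coeff_sFracConvergent_of_le (α : ℕ → ℝ) {m n : ℕ} (h : m ≤ n) (i : ℕ) :
    coeff m (sFracConvergent α n i) = coeff m (sFracConvergent α m i) := by
  induction n, h using Nat.le_induction with
  | base => rfl
  | succ n hn ih =>
    have := (X_pow_dvd_iff.1 (X_pow_dvd_sFracConvergent_succ_sub α n i)) m (by omega)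
    rw [map_sub, sub_eq_zero] at this
    rw [this, ih]

lemma exists_isSTailFamily (α : ℕ → ℝ) : ∃ F, IsSTailFamily α F := by
  refine ⟨fun i => mk fun m => coeff m (sFracConvergent α m i), fun i => ?_⟩
  have key : ∀ n i, (X : ℝ⟦X⟧) ^ (n + 1) ∣
      (mk fun m => coeff m (sFracConvergent α m i)) - sFracConvergent α n i := by
    intro n i
    refine X_pow_dvd_iff.2 fun m hm => ?_
    rw [map_sub, coeff_mk, coeff_sFracConvergent_of_le α (n := n) (by omega), sub_self]
  rw [← sub_eq_zero]
  ext m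
  obtain ⟨q, hq⟩ := key m (i + 1)
  obtain ⟨r, hr⟩ := key (m + 1) i
  have h := sFracConvergent_succ_mul α m i
  have hdvd : (X : ℝ⟦X⟧) ^ (m + 1) ∣ (mk fun m => coeff m (sFracConvergent α m i)) *
      (1 - C (α i) * X * mk fun m => coeff m (sFracConvergent α m (i + 1))) - 1 := by
    refine ⟨X * r * (1 - C (α i) * X * mk fun m => coeff m (sFracConvergent α m (i + 1)))
      - sFracConvergent α (m + 1) i * C (α i) * X * q, ?_⟩
    linear_combination h - sFracConvergent α (m + 1) i * C (α i) * X * hq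
      + (1 - C (α i) * X * mk fun m => coeff m (sFracConvergent α m (i + 1))) * hr
  simpa using X_pow_dvd_iff.1 hdvd m (by omega)

lemma IsSTailFamily.coeff_sFracConvergent {α : ℕ → ℝ} {F : ℕ → ℝ⟦X⟧} (hF : IsSTailFamily α F)
    {m n : ℕ} (h : m ≤ n) (i : ℕ) : coeff m (sFracConvergent α n i) = coeff m (F i) := by
  have key : ∀ n i, (X : ℝ⟦X⟧) ^ (n + 1) ∣ sFracConvergent α n i - F i := by
    intro n
    induction n with
    | zero =>
      intro i
      refine ⟨-(C (α i) * F i * F (i + 1)), ?_⟩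
      simp only [sFracConvergent.eq_1, zero_add, pow_one]
      linear_combination - hF i
    | succ n ih =>
      intro i
      exact X_pow_succ_dvd_sub_of_mul_eq_one (sFracConvergent_succ_mul α _ i) (hF i) (ih (i + 1))
  have := X_pow_dvd_iff.1 (key n i) m (by omega)
  rwa [map_sub, sub_eq_zero] at this

lemma IsSTailFamily.isSFraction_iff {α : ℕ → ℝ} {F : ℕ → ℝ⟦X⟧} (hF : IsSTailFamily α F)
    (f : ℝ⟦X⟧) (c : ℝ) : IsSFraction f c α ↔ f = C c * F 1 := by
  constructor
  · intro h
    ext m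
    obtain ⟨n, hn, hmn⟩ := ((h m).and (Filter.eventually_ge_atTop m)).exists
    rw [← hn, coeff_C_mul, coeff_C_mul, hF.coeff_sFracConvergent hmn]
  · rintro rfl m
    filter_upwards [Filter.eventually_ge_atTop m] with n hn
    rw [coeff_C_mul, coeff_C_mul, hF.coeff_sFracConvergent hn]

/-! ### Even contraction to J-fractions -/

/-- The power series `K j` are the tails of a Jacobi-type continued fraction. -/
def IsJTailFamily (γ δ : ℕ → ℝ) (K : ℕ → ℝ⟦X⟧) : Prop :=
  ∀ j, K j * (1 - C (γ j) * X - C (δ j) * X ^ 2 * K (j + 1)) = 1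

/-- The difference at level j is the difference at level j + 1 times a multiple of X, so it is
divisible by every power of X. -/
lemma IsJTailFamily.eq {γ δ : ℕ → ℝ} {K K' : ℕ → ℝ⟦X⟧} (hK : IsJTailFamily γ δ K)
    (hK' : IsJTailFamily γ δ K') (j : ℕ) : K j = K' j := by
  have key : ∀ n j, (X : ℝ⟦X⟧) ^ n ∣ K j - K' j := by
    intro n
    induction n with
    | zero => simp
    | succ n ih =>
      intro j
      obtain ⟨q, hq⟩ := ih (j + 1)
      refine ⟨C (δ j) * X * q * K j * K' j, ?_⟩
      linear_combination K' j * hK j - K j * hK' j + K j * K' j * C (δ j) * X ^ 2 * hq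
  rw [← sub_eq_zero]
  ext m
  simpa using X_pow_dvd_iff.1 (key (m + 1) j) m (by omega)

/-- Diagonal coefficients of the even contraction of an S-fraction. -/
def contractDiag (α : ℕ → ℝ) : ℕ → ℝ
  | 0 => α 1
  | j + 1 => α (2 * j + 2) + α (2 * j + 3)

/-- Tails of the even contraction of an S-fraction. -/
noncomputable def contractTail (F : ℕ → ℝ⟦X⟧) : ℕ → ℝ⟦X⟧
  | 0 => F 1
  | j + 1 => F (2 * j + 2) * F (2 * j + 3)

lemma IsSTailFamily.contract {α : ℕ → ℝ} {F : ℕ → ℝ⟦X⟧} (hF : IsSTailFamily α F) :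
    IsJTailFamily (contractDiag α) (fun j => α (2 * j + 1) * α (2 * j + 2)) (contractTail F) := by
  intro j
  cases j with
  | zero =>
    have h1 := hF 1
    have h2 := hF 2
    simp only [contractTail, contractDiag, map_mul, mul_zero, zero_add]
    linear_combination h1 + C (α 1) * X * F 1 * h2
  | succ j =>
    have h2 := hF (2 * j + 2)
    have h3 := hF (2 * j + 3)
    have h4 := hF (2 * j + 4)
    simp only [contractTail, contractDiag, map_mul, map_add, mul_add, mul_one, add_assoc,
      Nat.reduceAdd] at *
    linear_combination F (2 * j + 2) * h3 + h2
      + C (α (2 * j + 3)) * X * F (2 * j + 2) * F (2 * j + 3) * h4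

/-! ### Translation by ξ on generating functions -/

lemma hasSubst_X_mul (v : ℝ⟦X⟧) : HasSubst (X * v) :=
  HasSubst.of_constantCoeff_zero' (by simp)

/-- If `f` is the generating function of the moments `∫ xⁿ`, then `xiShift ξ f` is the one of
`∫ (x + ξ)ⁿ`: it is `f (t / (1 - ξ t)) / (1 - ξ t)`. -/
noncomputable def xiShift (ξ : ℝ) (f : ℝ⟦X⟧) : ℝ⟦X⟧ :=
  (1 - C ξ * X)⁻¹ * substAlgHom (R := ℝ) (hasSubst_X_mul (1 - C ξ * X)⁻¹) f

lemma one_sub_C_mul_X_mul_inv (ξ : ℝ) : (1 - C ξ * X) * (1 - C ξ * X : ℝ⟦X⟧)⁻¹ = 1 :=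
  PowerSeries.mul_inv_cancel _ (by simp)

lemma substAlgHom_C {a : ℝ⟦X⟧} (ha : HasSubst a) (c : ℝ) : substAlgHom (R := ℝ) ha (C c) = C c := by
  exact (substAlgHom (R := ℝ) ha).commutes c

lemma xiShift_C_mul (ξ c : ℝ) (f : ℝ⟦X⟧) : xiShift ξ (C c * f) = C c * xiShift ξ f := by
  have h := map_mul (substAlgHom (R := ℝ) (hasSubst_X_mul (1 - C ξ * X)⁻¹)) (C c) f
  rw [substAlgHom_C] at h
  unfold xiShift
  rw [show substAlgHom (R := ℝ) (hasSubst_X_mul (1 - C ξ * X)⁻¹) (C c * f) = _ from h]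
  exact mul_left_comm _ _ _

/-- With v = 1 / (1 - ξX), the substitution turns X into Xv. Multiplying the substituted denominator
by 1 - ξX clears one v from each term, and the new term -ξX joins the diagonal. -/
lemma IsJTailFamily.xiShift {γ δ : ℕ → ℝ} {K : ℕ → ℝ⟦X⟧} (hK : IsJTailFamily γ δ K) (ξ : ℝ) :
    IsJTailFamily (fun j => γ j + ξ) δ (fun j => xiShift ξ (K j)) := by
  intro j
  have hv := one_sub_C_mul_X_mul_inv ξ
  have h := congrArg (substAlgHom (R := ℝ) (hasSubst_X_mul (1 - C ξ * X)⁻¹)) (hK j)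
  simp only [map_mul, map_sub, map_pow, map_one, substAlgHom_C, substAlgHom_X] at h
  unfold _root_.xiShift
  set v : ℝ⟦X⟧ := (1 - C ξ * X)⁻¹
  set s : ℝ⟦X⟧ := substAlgHom (R := ℝ) (hasSubst_X_mul v) (K j)
  set s' : ℝ⟦X⟧ := substAlgHom (R := ℝ) (hasSubst_X_mul v) (K (j + 1))
  simp only [map_add]
  replace h : s * (1 - C (γ j) * (X * v) - C (δ j) * (X * v) ^ 2 * s') = 1 := h
  linear_combination h + s * hv

/-- The model is A j n = ∫ xʲ (x + ξ)ⁿ: the recurrence expands one factor x + ξ, so row 0 holds the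
translated moments. -/
lemma xiShift_mk_eq {ξ : ℝ} {b : ℕ → ℝ} {A : ℕ → ℕ → ℝ} (h0 : ∀ j, A j 0 = b j)
    (hA : ∀ j n, A j (n + 1) = ξ * A j n + A (j + 1) n) :
    xiShift ξ (PowerSeries.mk b) = PowerSeries.mk (A 0) := by
  have hv := one_sub_C_mul_X_mul_inv ξ
  have hstep : ∀ j, xiShift ξ (mk fun n => b (j + n)) * (1 - C ξ * X) =
      C (b j) + X * xiShift ξ (mk fun n => b (j + 1 + n)) := by
    intro j
    have h1 : (mk fun n => b (j + n)) = C (b j) + X * mk fun n => b (j + 1 + n) := by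
      ext n
      cases n with
      | zero => simp
      | succ n => simp [coeff_succ_X_mul, add_assoc, add_comm 1 n]
    have h := congrArg (substAlgHom (R := ℝ) (hasSubst_X_mul (1 - C ξ * X)⁻¹)) h1
    simp only [map_add, map_mul, substAlgHom_C, substAlgHom_X] at h
    unfold xiShift
    set v : ℝ⟦X⟧ := (1 - C ξ * X)⁻¹
    set s : ℝ⟦X⟧ := substAlgHom (R := ℝ) (hasSubst_X_mul v) (mk fun n => b (j + n))
    set s' : ℝ⟦X⟧ := substAlgHom (R := ℝ) (hasSubst_X_mul v) (mk fun n => b (j + 1 + n))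
    replace h : s = C (b j) + X * v * s' := h
    linear_combination s * hv + h
  have key : ∀ n j, coeff n (xiShift ξ (mk fun n => b (j + n))) = A j n := by
    intro n
    induction n with
    | zero =>
      intro j
      have := congrArg (coeff 0) (hstep j)
      simpa [h0] using this
    | succ n ih =>
      intro j
      have := congrArg (coeff (n + 1)) (hstep j)
      rw [mul_sub, mul_one, mul_left_comm, map_sub, map_add, coeff_C_mul, coeff_succ_mul_X,
        coeff_succ_X_mul, ih, ih, coeff_C] at this
      rw [hA]
      simp at this
      linarith
  ext n
  simpa using key n 0

lemma IsSTailFamily.eq_xiShift {ξ : ℝ} {α β : ℕ → ℝ} {F G : ℕ → ℝ⟦X⟧} (hF : IsSTailFamily α F)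
    (hG : IsSTailFamily β G) (hd : ∀ j, contractDiag α j = contractDiag β j + ξ)
    (ho : ∀ j, α (2 * j + 1) * α (2 * j + 2) = β (2 * j + 1) * β (2 * j + 2)) :
    F 1 = xiShift ξ (G 1) := by
  have h1 := hF.contract
  have h2 := hG.contract.xiShift ξ
  rw [← funext hd, ← funext ho] at h2
  exact h1.eq h2 0

/-- The coefficients `α` built from `g`, with `g 0 = 0`, are the `ξ`-shift of the coefficients `β`. -/
lemma IsSTailFamily.eq_xiShift_of_xiCoefficients {ξ : ℝ} {g α β : ℕ → ℝ} {F G : ℕ → ℝ⟦X⟧}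
    (hF : IsSTailFamily α F) (hG : IsSTailFamily β G) (h0 : g 0 = 0) (hg : ∀ i, 1 ≤ i → 0 ≤ g i)
    (hα : XiCoefficients ξ g α) (hodd : ∀ k, β (2 * k + 1) = g (2 * k + 1))
    (heven : ∀ k, β (2 * k + 2) = α (2 * k + 1) * g (2 * k + 2) / (1 + g (2 * k))) :
    F 1 = xiShift ξ (G 1) := by
  have hpos : ∀ k, 1 + g (2 * k) ≠ 0 := by
    intro k
    rcases Nat.eq_zero_or_pos (2 * k) with h | h
    · rw [h, h0]; norm_num
    · have := hg _ h
      positivity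
  refine hF.eq_xiShift hG (fun j => ?_) (fun j => ?_)
  · cases j with
    | zero =>
      have := (hα 0).1
      have h1 := hodd 0
      simp only [mul_zero, zero_add, contractDiag] at this h1 ⊢
      rw [this, h1, h0]
      ring
    | succ j =>
      have h3 := (hα (j + 1)).1
      have h3' := hodd (j + 1)
      simp only [mul_add, mul_one, add_assoc, Nat.reduceAdd] at h3 h3'
      simp only [contractDiag]
      rw [h3, h3', (hα j).2, heven, (hα j).1]
      have := hpos j
      field_simp
      ring
  · rw [hodd, heven, (hα j).2]
    ring

/-! ### Hankel positivity and extraction of S-fraction coefficients -/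

/-- The linear functional on polynomials with moments `a`. -/
noncomputable def momentFunctional (a : ℕ → ℝ) : Polynomial ℝ →ₗ[ℝ] ℝ :=
  Polynomial.lsum fun n => a n • LinearMap.id

@[simp] lemma momentFunctional_X_pow (a : ℕ → ℝ) (n : ℕ) :
    momentFunctional a (Polynomial.X ^ n) = a n := by
  rw [← Polynomial.monomial_one_right_eq_X_pow]
  simp [momentFunctional]

@[simp] lemma momentFunctional_one (a : ℕ → ℝ) : momentFunctional a 1 = a 0 := by
  simpa using momentFunctional_X_pow a 0

/-- The Hankel forms of `a` and of the shifted sequence are positive semidefinite. -/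
def IsHankelPos (a : ℕ → ℝ) : Prop :=
  ∀ p : Polynomial ℝ, 0 ≤ momentFunctional a (p * p) ∧
    0 ≤ momentFunctional a (Polynomial.X * (p * p))

lemma IsHankelPos.smul {a : ℕ → ℝ} (ha : IsHankelPos a) {c : ℝ} (hc : 0 ≤ c) :
    IsHankelPos (fun n => c * a n) := by
  have h : momentFunctional (fun n => c * a n) = c • momentFunctional a := by
    ext n
    simp [Polynomial.monomial_one_right_eq_X_pow]
  intro p
  rw [h]
  exact ⟨mul_nonneg hc (ha p).1, mul_nonneg hc (ha p).2⟩

lemma IsHankelPos.zero_nonneg {a : ℕ → ℝ} (ha : IsHankelPos a) : 0 ≤ a 0 := by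
  simpa using (ha 1).1

/-- When a 0 = 0, the form at xⁿ + s is affine in s with slope 2 a n; nonnegativity for all s forces
the slope to vanish. -/
lemma IsHankelPos.eq_zero {a : ℕ → ℝ} (ha : IsHankelPos a) (h0 : a 0 = 0) (n : ℕ) : a n = 0 := by
  have h : ∀ s : ℝ, 0 ≤ a (2 * n) + 2 * s * a n := by
    intro s
    have h1 := (ha (Polynomial.X ^ n + Polynomial.C s)).1
    have h2 : (Polynomial.X ^ n + Polynomial.C s) * (Polynomial.X ^ n + Polynomial.C s) =
        Polynomial.X ^ (2 * n) + (2 * s) • Polynomial.X ^ n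
          + (s * s) • (Polynomial.X : Polynomial ℝ) ^ 0 := by
      simp only [Polynomial.smul_eq_C_mul, map_mul, map_ofNat]
      ring
    rw [h2] at h1
    simpa [h0] using h1
  by_contra hn
  have := h (-(a (2 * n) + 1) / (2 * a n))
  have h3 : 2 * (-(a (2 * n) + 1) / (2 * a n)) * a n = -(a (2 * n) + 1) := by
    field_simp
  linarith

/-- The polynomials `∑ i ≤ j, u (j - i) xⁱ`. -/
noncomputable def toeplitzPoly (u : ℕ → ℝ) : ℕ → Polynomial ℝ
  | 0 => Polynomial.C (u 0)
  | j + 1 => Polynomial.X * toeplitzPoly u j + Polynomial.C (u (j + 1))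

lemma momentFunctional_toeplitzPoly (a u : ℕ → ℝ) (k j : ℕ) :
    momentFunctional a (Polynomial.X ^ k * toeplitzPoly u j) =
      coeff j ((PowerSeries.mk fun n => a (k + n)) * PowerSeries.mk u) := by
  have hC : ∀ (k : ℕ) (c : ℝ),
      momentFunctional a (Polynomial.X ^ k * Polynomial.C c) = a k * c := by
    intro k c
    rw [mul_comm, ← Polynomial.smul_eq_C_mul, map_smul, momentFunctional_X_pow, smul_eq_mul,
      mul_comm]
  induction j generalizing k with
  | zero => rw [toeplitzPoly, hC]; simp
  | succ j ih =>
    have h : (PowerSeries.mk fun n => a (k + n)) =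
        C (a k) + X * PowerSeries.mk fun n => a (k + 1 + n) := by
      ext n
      cases n with
      | zero => simp
      | succ n => simp [coeff_succ_X_mul, add_assoc, add_comm 1 n]
    rw [toeplitzPoly, mul_add, map_add, hC, ← mul_assoc, ← pow_succ, ih, h, add_mul, mul_assoc,
      map_add, coeff_C_mul, coeff_succ_X_mul, coeff_mk, add_comm]

/-- The linear map sending `xʲ` to `toeplitzPoly u j`. -/
noncomputable def toeplitzMap (u : ℕ → ℝ) : Polynomial ℝ →ₗ[ℝ] Polynomial ℝ :=
  Polynomial.lsum fun n => LinearMap.toSpanSingleton ℝ _ (toeplitzPoly u n)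

lemma toeplitzMap_X_pow (u : ℕ → ℝ) (n : ℕ) :
    toeplitzMap u (Polynomial.X ^ n) = toeplitzPoly u n := by
  rw [← Polynomial.monomial_one_right_eq_X_pow]
  simp [toeplitzMap]

lemma bilin_ext {M : Type*} [AddCommMonoid M] [Module ℝ M]
    {B B' : Polynomial ℝ →ₗ[ℝ] Polynomial ℝ →ₗ[ℝ] M}
    (h : ∀ j k, B (Polynomial.X ^ j) (Polynomial.X ^ k) = B' (Polynomial.X ^ j) (Polynomial.X ^ k)) :
    B = B' := by
  ext j k
  simpa [Polynomial.monomial_one_right_eq_X_pow] using h j k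

/-- Write T_j for the Toeplitz polynomials. Passing from X T_j T_{k+1} to X T_{j+1} T_k changes the
value by terms ± h j * h k that cancel, so it depends only on j + k and is read off at j = 0. -/
lemma momentFunctional_mul_toeplitzPoly {a u h : ℕ → ℝ} (ha : a 0 = 1)
    (hu : PowerSeries.mk a * PowerSeries.mk u = 1) (hh : ∀ n, u (n + 1) = -h n) (j k : ℕ) :
    momentFunctional a (Polynomial.X * (toeplitzPoly u j * toeplitzPoly u k)) = h (j + k) := by
  have hu0 : u 0 = 1 := by
    have := congrArg (coeff 0) hu
    simpa [coeff_mul, ha] using this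
  have hT : ∀ j, momentFunctional a (toeplitzPoly u (j + 1)) = 0 := by
    intro j
    have := momentFunctional_toeplitzPoly a u 0 (j + 1)
    simp only [pow_zero, one_mul, zero_add] at this
    rw [this, hu]
    simp [coeff_one]
  have hC : ∀ c : ℝ, momentFunctional a (Polynomial.C c) = c := by
    intro c
    rw [← mul_one (Polynomial.C c), ← Polynomial.smul_eq_C_mul, map_smul,
      momentFunctional_one, ha]
    simp
  have hX : ∀ j, momentFunctional a (Polynomial.X * toeplitzPoly u j) = h j := by
    intro j
    have := hT j
    rw [toeplitzPoly, map_add, hC, hh] at this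
    linarith
  induction j generalizing k with
  | zero =>
    rw [toeplitzPoly, hu0]
    simp [hX]
  | succ j ih =>
    have h1 := ih (k + 1)
    have e1 : Polynomial.X * (toeplitzPoly u j * toeplitzPoly u (k + 1)) =
        Polynomial.X * (Polynomial.X * (toeplitzPoly u j * toeplitzPoly u k))
          + u (k + 1) • (Polynomial.X * toeplitzPoly u j) := by
      simp only [toeplitzPoly, Polynomial.smul_eq_C_mul]
      ring
    have e2 : Polynomial.X * (toeplitzPoly u (j + 1) * toeplitzPoly u k) =
        Polynomial.X * (Polynomial.X * (toeplitzPoly u j * toeplitzPoly u k))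
          + u (j + 1) • (Polynomial.X * toeplitzPoly u k) := by
      simp only [toeplitzPoly, Polynomial.smul_eq_C_mul]
      ring
    rw [e1, map_add, map_smul, hX, hh, smul_eq_mul] at h1
    rw [e2, map_add, map_smul, hX, hh, smul_eq_mul, show j + 1 + k = j + (k + 1) by ring, ← h1]
    ring

lemma momentFunctional_mul_toeplitzPoly_succ {a u h : ℕ → ℝ} (ha : a 0 = 1)
    (hu : PowerSeries.mk a * PowerSeries.mk u = 1) (hh : ∀ n, u (n + 1) = -h n) (j k : ℕ) :
    momentFunctional a (toeplitzPoly u (j + 1) * toeplitzPoly u (k + 1)) = h (j + k + 1) := by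
  have hT : momentFunctional a (toeplitzPoly u (k + 1)) = 0 := by
    have := momentFunctional_toeplitzPoly a u 0 (k + 1)
    simp only [pow_zero, one_mul, zero_add] at this
    rw [this, hu]
    simp [coeff_one]
  have e : toeplitzPoly u (j + 1) * toeplitzPoly u (k + 1) =
      Polynomial.X * (toeplitzPoly u j * toeplitzPoly u (k + 1))
        + u (j + 1) • toeplitzPoly u (k + 1) := by
    rw [toeplitzPoly.eq_2 u j, Polynomial.smul_eq_C_mul]
    ring
  rw [e, map_add, map_smul, hT, momentFunctional_mul_toeplitzPoly ha hu hh, smul_zero, add_zero,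
    add_assoc]

/-- Here a has generating series 1 / (1 - t h). The Toeplitz matrix of 1/a is a congruence carrying
the shifted Hankel form of a to the Hankel form of h; composed with multiplication by x, it carries
the Hankel form of a to the shifted form of h. -/
lemma IsHankelPos.of_inv {a u h : ℕ → ℝ} (hpos : IsHankelPos a) (ha : a 0 = 1)
    (hu : PowerSeries.mk a * PowerSeries.mk u = 1) (hh : ∀ n, u (n + 1) = -h n) :
    IsHankelPos h := by
  have h1 : (LinearMap.mul ℝ (Polynomial ℝ)).compr₂ (momentFunctional h) =
      ((LinearMap.mul ℝ (Polynomial ℝ)).compr₂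
        (momentFunctional a ∘ₗ LinearMap.mulLeft ℝ Polynomial.X)).compl₁₂
          (toeplitzMap u) (toeplitzMap u) := by
    refine bilin_ext fun j k => ?_
    simp only [LinearMap.compr₂_apply, LinearMap.mul_apply', LinearMap.compl₁₂_apply,
      LinearMap.comp_apply, LinearMap.mulLeft_apply, toeplitzMap_X_pow, ← pow_add,
      momentFunctional_X_pow, momentFunctional_mul_toeplitzPoly ha hu hh]
  have h2 : (LinearMap.mul ℝ (Polynomial ℝ)).compr₂
        (momentFunctional h ∘ₗ LinearMap.mulLeft ℝ Polynomial.X) =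
      ((LinearMap.mul ℝ (Polynomial ℝ)).compr₂ (momentFunctional a)).compl₁₂
          (toeplitzMap u ∘ₗ LinearMap.mulLeft ℝ Polynomial.X)
          (toeplitzMap u ∘ₗ LinearMap.mulLeft ℝ Polynomial.X) := by
    refine bilin_ext fun j k => ?_
    simp only [LinearMap.compr₂_apply, LinearMap.mul_apply', LinearMap.compl₁₂_apply,
      LinearMap.comp_apply, LinearMap.mulLeft_apply, toeplitzMap_X_pow, ← pow_add, ← pow_succ',
      momentFunctional_X_pow, momentFunctional_mul_toeplitzPoly_succ ha hu hh]
  intro p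
  have e1 := LinearMap.congr_fun (LinearMap.congr_fun h1 p) p
  have e2 := LinearMap.congr_fun (LinearMap.congr_fun h2 p) p
  simp only [LinearMap.compr₂_apply, LinearMap.mul_apply', LinearMap.compl₁₂_apply,
    LinearMap.comp_apply, LinearMap.mulLeft_apply] at e1 e2
  rw [e1, e2]
  exact ⟨(hpos _).2, (hpos _).1⟩

lemma IsHankelPos.exists_next {a : ℕ → ℝ} (ha : IsHankelPos a) :
    ∃ h, IsHankelPos h ∧ (a 0 = 0 → h 0 = 0) ∧
      PowerSeries.mk a * (1 - X * PowerSeries.mk h) = C (a 0) := by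
  rcases eq_or_ne (a 0) 0 with h0 | h0
  · refine ⟨a, ha, id, ?_⟩
    have : PowerSeries.mk a = 0 := by
      ext n
      simp [ha.eq_zero h0]
    simp [this, h0]
  · set f : ℝ⟦X⟧ := PowerSeries.mk fun n => (a 0)⁻¹ * a n with hf
    have hc : constantCoeff f = 1 := by
      simp [hf, h0]
    have hinv : f * f⁻¹ = 1 := PowerSeries.mul_inv_cancel _ (by simp [hc])
    have hpos := ha.smul (inv_nonneg.2 ha.zero_nonneg)
    refine ⟨fun n => -coeff (n + 1) f⁻¹,
      hpos.of_inv (u := fun n => coeff n f⁻¹) (inv_mul_cancel₀ h0) ?_ (by simp),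
      fun h => absurd h h0, ?_⟩
    · convert hinv using 2
      ext n
      simp
    · have h1 : 1 - X * PowerSeries.mk (fun n => -coeff (n + 1) f⁻¹) = f⁻¹ := by
        ext n
        cases n with
        | zero => simp [hc]
        | succ n => simp [coeff_succ_X_mul, coeff_one]
      have h2 : PowerSeries.mk a = C (a 0) * f := by
        ext n
        simp [hf, h0]
      rw [h1, h2, mul_assoc, hinv, mul_one]

/-- A Hankel-positive sequence has an S-fraction with nonnegative coefficients, all of which vanish
after the first zero. -/
lemma IsHankelPos.exists_sFraction {a : ℕ → ℝ} (ha : IsHankelPos a) :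
    ∃ (β : ℕ → ℝ) (G : ℕ → ℝ⟦X⟧), (∀ i, 0 ≤ β i) ∧ (∀ i, β i = 0 → β (i + 1) = 0) ∧
      IsSTailFamily β G ∧ PowerSeries.mk a = C (β 0) * G 1 := by
  choose! N hN1 hN2 hN3 using fun (a : ℕ → ℝ) (ha : IsHankelPos a) => ha.exists_next
  have hpos : ∀ i, IsHankelPos (N^[i] a) := by
    intro i
    induction i with
    | zero => exact ha
    | succ i ih =>
      rw [Function.iterate_succ_apply']
      exact hN1 _ ih
  have hinv : ∀ i, (1 - X * PowerSeries.mk (N^[i] a)) * (1 - X * PowerSeries.mk (N^[i] a))⁻¹ = 1 :=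
    fun i => PowerSeries.mul_inv_cancel _ (by simp)
  have key : ∀ i, PowerSeries.mk (N^[i] a) =
      C (N^[i] a 0) * (1 - X * PowerSeries.mk (N^[i + 1] a))⁻¹ := by
    intro i
    have h := hN3 _ (hpos i)
    rw [← Function.iterate_succ_apply' N] at h
    rw [← h, mul_assoc, hinv, mul_one]
  refine ⟨fun i => N^[i] a 0, fun i => (1 - X * PowerSeries.mk (N^[i] a))⁻¹,
    fun i => (hpos i).zero_nonneg, fun i hi => ?_, fun i => ?_, key 0⟩
  · simp only [Function.iterate_succ_apply']
    exact hN2 _ (hpos i) hi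
  · have h1 := key i
    have h2 := hinv i
    linear_combination h2 + X * (1 - X * PowerSeries.mk (N^[i] a))⁻¹ * h1

/-! ### Convergents as moments of Gram matrices -/

lemma eq_zero_of_eq_X_mul_succ {D : ℕ → ℝ⟦X⟧} (hD : ∀ k, D k = X * D (k + 1)) (k : ℕ) : D k = 0 := by
  have key : ∀ n k, coeff n (D k) = 0 := by
    intro n
    induction n with
    | zero => intro k; rw [hD]; simp
    | succ n ih => intro k; rw [hD, coeff_succ_X_mul, ih]
  ext n
  simp [key]

section Matrix

open Matrix

variable {ι : Type} [Fintype ι] [DecidableEq ι]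

/-- Formal Sherman–Morrison identity for a rank-one perturbation. Inserting Aᵏ in front gives a
family whose defects satisfy D k = X * D (k + 1), hence vanish. -/
lemma mk_dotProduct_add_vecMulVec_pow (A : Matrix ι ι ℝ) (v : ι → ℝ) :
    (PowerSeries.mk fun n => v ⬝ᵥ ((A + vecMulVec v v) ^ n *ᵥ v)) =
      (PowerSeries.mk fun n => v ⬝ᵥ (A ^ n *ᵥ v)) *
        (1 + X * PowerSeries.mk fun n => v ⬝ᵥ ((A + vecMulVec v v) ^ n *ᵥ v)) := by
  set Q : ℝ⟦X⟧ := PowerSeries.mk fun n => v ⬝ᵥ ((A + vecMulVec v v) ^ n *ᵥ v) with hQ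
  let R : ℕ → ℝ⟦X⟧ := fun k =>
    PowerSeries.mk fun n => v ⬝ᵥ (A ^ k *ᵥ ((A + vecMulVec v v) ^ n *ᵥ v))
  let H : ℕ → ℝ⟦X⟧ := fun k => PowerSeries.mk fun n => v ⬝ᵥ (A ^ (k + n) *ᵥ v)
  have hH : ∀ k, H k = C (v ⬝ᵥ (A ^ k *ᵥ v)) + X * H (k + 1) := by
    intro k
    ext n
    cases n with
    | zero => simp [H]
    | succ n => simp [H, coeff_succ_X_mul, add_assoc, add_comm 1 n]
  have hR : ∀ k, R k = C (v ⬝ᵥ (A ^ k *ᵥ v)) + X * (R (k + 1) + C (v ⬝ᵥ (A ^ k *ᵥ v)) * Q) := by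
    intro k
    ext n
    cases n with
    | zero => simp [R]
    | succ n =>
      simp only [R, hQ, coeff_mk, map_add, coeff_succ_X_mul, coeff_C_mul, coeff_C,
        Nat.succ_ne_zero, if_false, zero_add]
      rw [pow_succ' (A + vecMulVec v v), ← mulVec_mulVec _ (A + vecMulVec v v), add_mulVec,
        vecMulVec_mulVec, mulVec_add, dotProduct_add, mulVec_mulVec _ (A ^ k) A, ← pow_succ]
      simp [mulVec_smul, mul_comm]
  have key := eq_zero_of_eq_X_mul_succ (D := fun k => R k - H k * (1 + X * Q)) (fun k => by
    linear_combination hR k - (1 + X * Q) * hH k) 0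
  have hR0 : R 0 = Q := by simp [R, hQ]
  have hH0 : H 0 = PowerSeries.mk fun n => v ⬝ᵥ (A ^ n *ᵥ v) := by simp [H]
  rw [hR0, hH0, sub_eq_zero] at key
  exact key

/-- If `h` is the moment sequence of a vector for the Gram matrix of `D`, then `1 / (1 - t h)` is
also the moment sequence of a vector for a Gram matrix. -/
lemma exists_gram_inv {κ : Type} [Fintype κ] [DecidableEq κ] (D : Matrix κ ι ℝ) (v : ι → ℝ) :
    ∃ (E : Matrix ι (Unit ⊕ κ) ℝ) (e : Unit ⊕ κ → ℝ),
      (PowerSeries.mk fun n => e ⬝ᵥ ((Eᵀ * E) ^ n *ᵥ e)) *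
        (1 - X * PowerSeries.mk fun n => v ⬝ᵥ ((Dᵀ * D) ^ n *ᵥ v)) = 1 := by
  -- E is Dᵀ with the extra column v, and e selects that column. Thus E Eᵀ is the rank-one
  -- perturbation of DᵀD by v.
  set E : Matrix ι (Unit ⊕ κ) ℝ := (fromRows (replicateRow Unit v) D)ᵀ with hE
  set e : Unit ⊕ κ → ℝ := Sum.elim (fun _ => 1) 0 with he
  have hEe : E *ᵥ e = v := by
    ext j
    simp [hE, he, mulVec, dotProduct, Fintype.sum_sum_type]
  have hEE : E * Eᵀ = Dᵀ * D + vecMulVec v v := by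
    rw [hE, transpose_transpose, transpose_fromRows, fromCols_mul_fromRows, add_comm]
    congr 1
    ext i j
    simp [mul_apply, vecMulVec_apply]
  have hpow : ∀ n : ℕ, (Eᵀ * E) ^ (n + 1) = Eᵀ * (E * Eᵀ) ^ n * E := by
    intro n
    induction n with
    | zero => simp
    | succ n ih => rw [pow_succ, ih, pow_succ (E * Eᵀ)]; simp only [Matrix.mul_assoc]
  have hsucc : ∀ n : ℕ, e ⬝ᵥ ((Eᵀ * E) ^ (n + 1) *ᵥ e) =
      v ⬝ᵥ ((Dᵀ * D + vecMulVec v v) ^ n *ᵥ v) := by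
    intro n
    rw [hpow, ← mulVec_mulVec, hEe, ← mulVec_mulVec, dotProduct_mulVec, vecMul_transpose, hEe, hEE]
  refine ⟨E, e, ?_⟩
  have h1 : (PowerSeries.mk fun n => e ⬝ᵥ ((Eᵀ * E) ^ n *ᵥ e)) =
      1 + X * PowerSeries.mk fun n => v ⬝ᵥ ((Dᵀ * D + vecMulVec v v) ^ n *ᵥ v) := by
    ext n
    cases n with
    | zero => simp [he, dotProduct, Fintype.sum_sum_type]
    | succ n => simp [coeff_succ_X_mul, coeff_one, hsucc]
  have h2 := mk_dotProduct_add_vecMulVec_pow (Dᵀ * D) v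
  rw [h1]
  linear_combination X * h2

lemma dotProduct_pow_mulVec_eq_sum {A : Matrix ι ι ℝ} (hA : A.IsHermitian) (v : ι → ℝ) (n : ℕ) :
    v ⬝ᵥ (A ^ n *ᵥ v) =
      ∑ j, (v ⬝ᵥ (hA.eigenvectorBasis j).ofLp) ^ 2 * hA.eigenvalues j ^ n := by
  have hpow : ∀ j, A ^ n *ᵥ (hA.eigenvectorBasis j).ofLp =
      hA.eigenvalues j ^ n • (hA.eigenvectorBasis j).ofLp := by
    intro j
    induction n with
    | zero => simp
    | succ n ih =>
      rw [pow_succ, ← mulVec_mulVec, hA.mulVec_eigenvectorBasis, mulVec_smul, ih, smul_smul,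
        pow_succ']
  have h := hA.eigenvectorBasis.sum_inner_mul_inner (WithLp.toLp 2 v) (WithLp.toLp 2 (A ^ n *ᵥ v))
  have hT : (A ^ n)ᵀ = A ^ n := by
    rw [← conjTranspose_eq_transpose_of_trivial]
    exact (hA.pow n).eq
  simp only [EuclideanSpace.inner_eq_star_dotProduct, star_trivial] at h
  rw [dotProduct_comm, ← h]
  refine Finset.sum_congr rfl fun j _ => ?_
  rw [dotProduct_comm (A ^ n *ᵥ v), dotProduct_mulVec, ← mulVec_transpose, hT, hpow,
    smul_dotProduct, dotProduct_comm _ v, smul_eq_mul]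
  ring

end Matrix

lemma exists_gram_sFracConvergent {β : ℕ → ℝ} (hβ : ∀ i, 1 ≤ i → 0 ≤ β i) (n i : ℕ)
    (hi : 1 ≤ i) :
    ∃ (ι κ : Type) (_ : Fintype ι) (_ : DecidableEq ι) (_ : Fintype κ) (_ : DecidableEq κ)
      (D : Matrix κ ι ℝ) (v : ι → ℝ),
      (PowerSeries.mk fun n => v ⬝ᵥ (((D.transpose * D) ^ n).mulVec v)) =
        sFracConvergent β n i := by
  induction n generalizing i with
  | zero =>
    refine ⟨Unit, Unit, inferInstance, inferInstance, inferInstance, inferInstance, 0, 1, ?_⟩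
    ext n
    cases n with
    | zero => simp [sFracConvergent]
    | succ n => simp [sFracConvergent, coeff_one]
  | succ n ih =>
    obtain ⟨ι, κ, _, _, _, _, D, v, hv⟩ := ih (i + 1) (by omega)
    -- Scaling the vector by √(β i) multiplies its moments by β i; this is where nonnegativity
    -- enters.
    obtain ⟨E, e, he⟩ := exists_gram_inv D (√(β i) • v)
    refine ⟨_, _, inferInstance, inferInstance, inferInstance, inferInstance, E, e, ?_⟩
    have h1 : (PowerSeries.mk fun n =>
        (√(β i) • v) ⬝ᵥ (((D.transpose * D) ^ n).mulVec (√(β i) • v))) =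
        C (β i) * sFracConvergent β n (i + 1) := by
      rw [← hv]
      ext n
      simp [Matrix.mulVec_smul, ← mul_assoc, Real.mul_self_sqrt (hβ i hi)]
    rw [h1, mul_left_comm, ← mul_assoc] at he
    rw [sFracConvergent, PowerSeries.eq_inv_iff_mul_eq_one (by simp)]
    exact he

/-- This is the spectral measure of v for DᵀD: atoms at the eigenvalues, which are nonnegative,
weighted by squared coordinates of v. -/
lemma exists_measure_sFracConvergent {β : ℕ → ℝ} (hβ : ∀ i, 1 ≤ i → 0 ≤ β i) (n : ℕ) :
    ∃ μ : Measure ℝ, IsProbabilityMeasure μ ∧ (∀ᵐ x ∂μ, 0 ≤ x) ∧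
      ∀ m : ℕ, Integrable (fun x : ℝ => x ^ m) μ ∧
        ∫ x, x ^ m ∂μ = coeff m (sFracConvergent β n 1) := by
  obtain ⟨ι, κ, _, _, _, _, D, v, hv⟩ := exists_gram_sFracConvergent hβ n 1 le_rfl
  have hA : (D.transpose * D).PosSemidef := by
    simpa using Matrix.posSemidef_conjTranspose_mul_self D
  set μ : Measure ℝ := ∑ j, ENNReal.ofReal ((v ⬝ᵥ (hA.1.eigenvectorBasis j).ofLp) ^ 2) •
    Measure.dirac (hA.1.eigenvalues j) with hμ
  have hfin : IsFiniteMeasure μ := by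
    refine ⟨?_⟩
    simp [hμ, ENNReal.sum_lt_top]
  have hint : ∀ m : ℕ, Integrable (fun x : ℝ => x ^ m) μ := by
    intro m
    rw [hμ, integrable_finsetSum_measure]
    intro j _
    exact (integrable_dirac (by simp)).smul_measure ENNReal.ofReal_ne_top
  have hmom : ∀ m : ℕ, ∫ x, x ^ m ∂μ = coeff m (sFracConvergent β n 1) := by
    intro m
    rw [hμ, integral_finsetSum_measure]
    · rw [← hv, coeff_mk, dotProduct_pow_mulVec_eq_sum hA.1]
      refine Finset.sum_congr rfl fun j _ => ?_
      rw [integral_smul_measure, integral_dirac, ENNReal.toReal_ofReal (sq_nonneg _), smul_eq_mul]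
    · intro j _
      exact (integrable_dirac (by simp)).smul_measure ENNReal.ofReal_ne_top
  refine ⟨μ, ⟨?_⟩, ?_, fun m => ⟨hint m, hmom m⟩⟩
  · have h0 := hmom 0
    rw [coeff_sFracConvergent_of_le β (Nat.zero_le n)] at h0
    simp only [pow_zero, integral_const, sFracConvergent, smul_eq_mul, mul_one, coeff_zero_eq_constantCoeff,
      map_one] at h0
    rw [← ENNReal.toReal_eq_one_iff]
    exact h0
  · rw [hμ, ae_iff]
    simp only [Measure.coe_finsetSum, Finset.sum_apply, Measure.smul_apply, smul_eq_mul,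
      Finset.sum_eq_zero_iff, Finset.mem_univ, true_imp_iff]
    intro j
    rw [Measure.dirac_apply' _ (by measurability)]
    simp [hA.eigenvalues_nonneg j]

/-! ### Limits of measures with prescribed moments -/

open Filter Topology in
/-- A sequence of probability measures on `[0, ∞)` whose moments eventually agree with `a` has a
limit point with moments `a`. -/
lemma exists_measure_of_moments_eventually_eq {a : ℕ → ℝ} (μ : ℕ → Measure ℝ)
    [hprob : ∀ N, IsProbabilityMeasure (μ N)] (hnn : ∀ N, ∀ᵐ x ∂μ N, 0 ≤ x)
    (hint : ∀ N n, Integrable (fun x : ℝ => x ^ n) (μ N))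
    (hmom : ∀ N n, n ≤ N → ∫ x, x ^ n ∂μ N = a n) :
    ∃ ν : Measure ℝ, IsProbabilityMeasure ν ∧ (∀ᵐ x ∂ν, 0 ≤ x) ∧
      ∀ n, Integrable (fun x : ℝ => x ^ n) ν ∧ a n = ∫ x, x ^ n ∂ν := by
  -- The index shift makes every first moment equal to a 1, so Markov's inequality gives uniform
  -- tightness.
  let P : ℕ → ProbabilityMeasure ℝ := fun N => ⟨μ (N + 1), hprob _⟩
  have htight : IsTightMeasureSet {x : Measure ℝ | ∃ ρ ∈ Set.range P, (ρ : Measure ℝ) = x} := by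
    refine isTightMeasureSet_of_tendsto_measure_norm_gt ?_
    have hlim : Tendsto (fun r : ℝ => ENNReal.ofReal (a 1 / r)) atTop (𝓝 0) := by
      rw [← ENNReal.ofReal_zero]
      exact ENNReal.tendsto_ofReal (tendsto_const_nhds.div_atTop tendsto_id)
    refine tendsto_of_tendsto_of_tendsto_of_le_of_le' tendsto_const_nhds hlim
      (Eventually.of_forall fun _ => zero_le) ?_
    filter_upwards [eventually_gt_atTop 0] with r hr
    refine iSup₂_le ?_
    rintro _ ⟨_, ⟨N, rfl⟩, rfl⟩
    change μ (N + 1) {x | r < ‖x‖} ≤ _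
    have h1 : μ (N + 1) {x | r < ‖x‖} ≤ μ (N + 1) {x | r ≤ x} := by
      refine measure_mono_ae ?_
      filter_upwards [hnn (N + 1)] with x hx hxr
      have hxr' : r < ‖x‖ := hxr
      rw [Real.norm_of_nonneg hx] at hxr'
      exact hxr'.le
    refine h1.trans ?_
    have h2 := mul_meas_ge_le_integral_of_nonneg (μ := μ (N + 1)) (f := fun x : ℝ => x ^ 1)
      (by filter_upwards [hnn (N + 1)] with x hx; simpa using hx) (hint _ 1) r
    rw [hmom _ 1 (by omega)] at h2
    simp only [pow_one] at h2
    rw [← ofReal_measureReal]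
    exact ENNReal.ofReal_le_ofReal ((le_div_iff₀ hr).2 (by linarith))
  obtain ⟨ν, -, hν⟩ := (isCompact_closure_of_isTightMeasureSet htight).ultrafilter_le_nhds
    ((Ultrafilter.of atTop).map P) (by
      rw [le_principal_iff]
      exact Filter.mem_of_superset (Filter.range_mem_map) subset_closure)
  set U : Filter ℕ := (Ultrafilter.of (atTop : Filter ℕ) : Filter ℕ) with hU
  have hUle : U ≤ atTop := Ultrafilter.of_le _
  have hten : Tendsto P U (𝓝 ν) := hν
  rw [ProbabilityMeasure.tendsto_iff_forall_integral_tendsto] at hten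
  have htest : ∀ (f : ℝ → ℝ) (hf : Continuous f) (R : ℝ) (hR : ∀ x, ‖f x‖ ≤ R),
      Tendsto (fun N => ∫ x, f x ∂μ (N + 1)) U (𝓝 (∫ x, f x ∂(ν : Measure ℝ))) :=
    fun f hf R hR => hten (BoundedContinuousFunction.ofNormedAddCommGroup f hf R hR)
  have hnonneg : ∀ᵐ x ∂(ν : Measure ℝ), 0 ≤ x := by
    have hc : Continuous fun x : ℝ => min (max (-x) 0) 1 := by fun_prop
    have hb : ∀ x : ℝ, ‖min (max (-x) 0) 1‖ ≤ 1 := by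
      intro x
      rw [Real.norm_of_nonneg (le_min (le_max_right _ _) zero_le_one)]
      exact min_le_right _ _
    have h := htest _ hc 1 hb
    have h0 : ∀ N, ∫ x, min (max (-x) 0) 1 ∂μ (N + 1) = 0 := by
      intro N
      refine integral_eq_zero_of_ae ?_
      filter_upwards [hnn (N + 1)] with x hx
      simp [hx]
    simp only [h0] at h
    have h1 := tendsto_nhds_unique tendsto_const_nhds h
    have h2 := (integral_eq_zero_iff_of_nonneg
      (fun x : ℝ => le_min (le_max_right _ _) zero_le_one)
      (Integrable.of_bound hc.aestronglyMeasurable 1 (Eventually.of_forall hb))).1 h1.symm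
    filter_upwards [h2] with x hx
    by_contra hneg
    have h3 : 0 < min (max (-x) 0) 1 := lt_min (lt_max_of_lt_left (by linarith)) one_pos
    exact h3.ne' hx
  have hcont : ∀ (n : ℕ) (R : ℝ), Continuous fun x : ℝ => min (|x| ^ n) R := by
    intro n R
    fun_prop
  have hbound : ∀ (n R : ℕ) (x : ℝ), ‖min (|x| ^ n) (R : ℝ)‖ ≤ R := by
    intro n R x
    rw [Real.norm_of_nonneg (le_min (by positivity) (by positivity))]
    exact min_le_right _ _
  have hpow : ∀ (N n : ℕ), ∫ x, |x| ^ n ∂μ N = ∫ x, x ^ n ∂μ N := by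
    intro N n
    refine integral_congr_ae ?_
    filter_upwards [hnn N] with x hx
    rw [abs_of_nonneg hx]
  have hintabs : ∀ N n : ℕ, Integrable (fun x : ℝ => |x| ^ n) (μ N) := by
    intro N n
    refine (hint N n).congr ?_
    filter_upwards [hnn N] with x hx
    rw [abs_of_nonneg hx]
  have hintmin : ∀ (ρ : Measure ℝ) [IsFiniteMeasure ρ] (n R : ℕ),
      Integrable (fun x : ℝ => min (|x| ^ n) (R : ℝ)) ρ := fun ρ _ n R =>
    Integrable.of_bound (hcont n R).aestronglyMeasurable R (Eventually.of_forall (hbound n R))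
  have hupper : ∀ n R : ℕ, ∫ x, min (|x| ^ n) (R : ℝ) ∂(ν : Measure ℝ) ≤ a n := by
    intro n R
    refine le_of_tendsto (htest _ (hcont n R) R (hbound n R)) ?_
    filter_upwards [hUle (eventually_ge_atTop n)] with N hN
    rw [← hmom (N + 1) n (by omega), ← hpow]
    exact integral_mono (hintmin _ n R) (hintabs _ n) fun x => min_le_left _ _
  have hlower : ∀ n R : ℕ, 0 < R →
      a n - a (2 * n) / R ≤ ∫ x, min (|x| ^ n) (R : ℝ) ∂(ν : Measure ℝ) := by
    intro n R hR
    refine ge_of_tendsto (htest _ (hcont n R) R (hbound n R)) ?_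
    filter_upwards [hUle (eventually_ge_atTop (2 * n))] with N hN
    rw [← hmom (N + 1) n (by omega), ← hmom (N + 1) (2 * n) (by omega), ← hpow, ← hpow,
      ← integral_div, ← integral_sub (hintabs _ _) ((hintabs _ _).div_const _)]
    refine integral_mono ((hintabs _ _).sub ((hintabs _ _).div_const _)) (hintmin _ n R)
      fun x => ?_
    have hR' : (0 : ℝ) < R := by exact_mod_cast hR
    have hx : 0 ≤ |x| ^ n := by positivity
    change |x| ^ n - |x| ^ (2 * n) / R ≤ min (|x| ^ n) (R : ℝ)
    rw [mul_comm 2 n, pow_mul]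
    generalize |x| ^ n = y at hx
    have hy : 0 ≤ y ^ 2 / R := by positivity
    refine le_min (by linarith) ?_
    have h1 : y - y ^ 2 / R - R = -((y ^ 2 - y * R + R ^ 2) / R) := by
      field_simp
      ring
    have h2 : 0 ≤ (y ^ 2 - y * R + R ^ 2) / R :=
      div_nonneg (by nlinarith [sq_nonneg (y - R), mul_nonneg hx hR'.le]) hR'.le
    linarith
  have hpt : ∀ (n : ℕ) (x : ℝ), Tendsto (fun R : ℕ => min (|x| ^ n) (R : ℝ)) atTop (𝓝 (|x| ^ n)) := by
    intro n x
    obtain ⟨R₀, hR₀⟩ := exists_nat_ge (|x| ^ n)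
    refine tendsto_const_nhds.congr' ?_
    filter_upwards [eventually_ge_atTop R₀] with R hR
    exact (min_eq_left (hR₀.trans (by exact_mod_cast hR))).symm
  have hintν : ∀ n : ℕ, Integrable (fun x : ℝ => |x| ^ n) (ν : Measure ℝ) := by
    intro n
    refine integrable_of_tendsto (G := fun R x => min (|x| ^ n) (R : ℝ))
      (Eventually.of_forall (hpt n)) (fun R => (hcont n R).aestronglyMeasurable) ?_
    have hle : ∀ R : ℕ, ∫⁻ x, ‖min (|x| ^ n) (R : ℝ)‖ₑ ∂(ν : Measure ℝ) ≤ ENNReal.ofReal (a n) := by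
      intro R
      have hnn' : ∀ x : ℝ, 0 ≤ min (|x| ^ n) (R : ℝ) := fun x => le_min (by positivity) (by positivity)
      simp_rw [Real.enorm_of_nonneg (hnn' _)]
      rw [← ofReal_integral_eq_lintegral_ofReal (hintmin _ n R) (Eventually.of_forall hnn')]
      exact ENNReal.ofReal_le_ofReal (hupper n R)
    refine ne_top_of_le_ne_top (ENNReal.ofReal_ne_top (r := a n)) (liminf_le_of_le (by isBoundedDefault)
      fun b hb => ?_)
    obtain ⟨R, hR⟩ := hb.exists
    exact hR.trans (hle R)
  have hlimν : ∀ n : ℕ, ∫ x, |x| ^ n ∂(ν : Measure ℝ) = a n := by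
    intro n
    have hdom : Tendsto (fun R : ℕ => ∫ x, min (|x| ^ n) (R : ℝ) ∂(ν : Measure ℝ)) atTop
        (𝓝 (∫ x, |x| ^ n ∂(ν : Measure ℝ))) :=
      tendsto_integral_of_dominated_convergence (fun x => |x| ^ n)
        (fun R => (hcont n R).aestronglyMeasurable) (hintν n)
        (fun R => Eventually.of_forall fun x => by
          rw [Real.norm_of_nonneg (le_min (by positivity) (by positivity))]
          exact min_le_left _ _) (Eventually.of_forall (hpt n))
    refine tendsto_nhds_unique hdom ?_
    have h1 : Tendsto (fun R : ℕ => a n - a (2 * n) / (R : ℝ)) atTop (𝓝 (a n)) := by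
      simpa using (tendsto_const_nhds (x := a n)).sub
        (tendsto_const_div_atTop_nhds_zero_nat (a (2 * n)))
    refine tendsto_of_tendsto_of_tendsto_of_le_of_le' h1 tendsto_const_nhds ?_
      (Eventually.of_forall (hupper n))
    filter_upwards [eventually_gt_atTop 0] with R hR using hlower n R hR
  refine ⟨ν, inferInstance, hnonneg, fun n => ?_⟩
  have hae : (fun x : ℝ => |x| ^ n) =ᵐ[(ν : Measure ℝ)] fun x => x ^ n := by
    filter_upwards [hnonneg] with x hx
    rw [abs_of_nonneg hx]
  exact ⟨(hintν n).congr hae, by rw [← hlimν n, integral_congr_ae hae]⟩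

lemma support_subset_Ici_iff (μ : Measure ℝ) (ξ : ℝ) :
    μ.support ⊆ Set.Ici ξ ↔ ∀ᵐ x ∂μ, ξ ≤ x := by
  constructor
  · intro h
    filter_upwards [Measure.support_mem_ae (μ := μ)] with x hx using h hx
  · exact fun h => Measure.support_subset_of_isClosed isClosed_Ici h

lemma IsSTailFamily.isXiStieltjes {β : ℕ → ℝ} {G : ℕ → ℝ⟦X⟧} (hG : IsSTailFamily β G)
    (hβ : ∀ i, 1 ≤ i → 0 ≤ β i) {c : ℝ} (hc : 0 ≤ c) :
    IsXiStieltjes 0 (fun n => coeff n (C c * G 1)) := by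
  choose μ hprob hnn hmom using exists_measure_sFracConvergent hβ
  obtain ⟨ν, -, hν0, hν⟩ := exists_measure_of_moments_eventually_eq (a := fun n => coeff n (G 1)) μ
    hnn (fun N n => (hmom N n).1)
    (fun N n hn => by rw [(hmom N n).2, hG.coeff_sFracConvergent hn])
  refine ⟨ENNReal.ofReal c • ν, ?_, fun n => ⟨(hν n).1.smul_measure ENNReal.ofReal_ne_top, ?_⟩⟩
  · rw [support_subset_Ici_iff]
    exact Measure.ae_smul_measure hν0 _
  · rw [integral_smul_measure, ← (hν n).2, ENNReal.toReal_ofReal hc, smul_eq_mul]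
    exact coeff_C_mul _ _ _

lemma IsXiStieltjes.isHankelPos {b : ℕ → ℝ} (hb : IsXiStieltjes 0 b) : IsHankelPos b := by
  obtain ⟨μ, hμ, hmom⟩ := hb
  rw [support_subset_Ici_iff] at hμ
  have key : ∀ p : Polynomial ℝ, Integrable (fun x => p.eval x) μ ∧
      momentFunctional b p = ∫ x, p.eval x ∂μ := by
    intro p
    induction p using Polynomial.induction_on' with
    | add p q hp hq =>
      simp only [Polynomial.eval_add, map_add]
      exact ⟨hp.1.add hq.1, by rw [integral_add hp.1 hq.1, hp.2, hq.2]⟩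
    | monomial n c =>
      rw [← mul_one c, ← smul_eq_mul, ← Polynomial.smul_monomial,
        Polynomial.monomial_one_right_eq_X_pow]
      simp only [Polynomial.eval_smul, Polynomial.eval_pow, Polynomial.eval_X, map_smul,
        momentFunctional_X_pow, smul_eq_mul]
      exact ⟨(hmom n).1.const_mul c, by rw [integral_const_mul, (hmom n).2]⟩
  intro p
  rw [(key _).2, (key _).2]
  constructor
  · exact integral_nonneg fun x => by simpa using mul_self_nonneg _
  · refine integral_nonneg_of_ae ?_
    filter_upwards [hμ] with x hx
    simpa using mul_nonneg hx (mul_self_nonneg _)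

lemma integrable_comp_add_pow {μ : Measure ℝ} (h : ∀ n : ℕ, Integrable (fun x : ℝ => x ^ n) μ)
    (s : ℝ) (j n : ℕ) : Integrable (fun x : ℝ => x ^ j * (x + s) ^ n) μ := by
  induction n generalizing j with
  | zero => simpa using h j
  | succ n ih =>
    refine ((ih (j + 1)).add ((ih j).const_mul s)).congr (Filter.Eventually.of_forall fun x => ?_)
    simp only [Pi.add_apply]
    ring

lemma xiShift_mk_integral {μ : Measure ℝ} (h : ∀ n : ℕ, Integrable (fun x : ℝ => x ^ n) μ) (ξ : ℝ) :
    xiShift ξ (PowerSeries.mk fun n => ∫ x, x ^ n ∂μ) =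
      PowerSeries.mk fun n => ∫ x, (x + ξ) ^ n ∂μ := by
  have := xiShift_mk_eq (ξ := ξ) (b := fun n => ∫ x, x ^ n ∂μ)
    (A := fun j n => ∫ x, x ^ j * (x + ξ) ^ n ∂μ) (by simp) (fun j n => by
      rw [← integral_const_mul, ← integral_add ((integrable_comp_add_pow h ξ j n).const_mul ξ)
        (integrable_comp_add_pow h ξ (j + 1) n)]
      refine integral_congr_ae (Filter.Eventually.of_forall fun x => ?_)
      simp only
      ring)
  simpa using this

lemma isXiStieltjes_iff (ξ : ℝ) (a : ℕ → ℝ) : IsXiStieltjes ξ a ↔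
    ∃ b, IsXiStieltjes 0 b ∧ PowerSeries.mk a = xiShift ξ (PowerSeries.mk b) := by
  have hmap : ∀ (μ : Measure ℝ) (s : ℝ), (∀ n : ℕ, Integrable (fun x : ℝ => x ^ n) μ) → ∀ n : ℕ,
      Integrable (fun x : ℝ => x ^ n) (μ.map (· + s)) ∧
        ∫ x, x ^ n ∂(μ.map (· + s)) = ∫ x, (x + s) ^ n ∂μ := by
    intro μ s h n
    constructor
    · rw [integrable_map_measure (by fun_prop) (by fun_prop)]
      simpa [Function.comp_def] using integrable_comp_add_pow h s 0 n
    · rw [integral_map (by fun_prop) (by fun_prop)]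
  constructor
  · rintro ⟨μ, hμ, hmom⟩
    rw [support_subset_Ici_iff] at hμ
    have hν := hmap μ (-ξ) fun n => (hmom n).1
    refine ⟨fun n => ∫ x, x ^ n ∂(μ.map (· + -ξ)), ⟨μ.map (· + -ξ), ?_, fun n =>
      ⟨(hν n).1, rfl⟩⟩, ?_⟩
    · rw [support_subset_Ici_iff, ae_map_iff (by fun_prop) measurableSet_Ici]
      filter_upwards [hμ] with x hx
      linarith
    · rw [xiShift_mk_integral fun n => (hν n).1]
      congr 1
      ext n
      rw [integral_map (by fun_prop) (by fun_prop), (hmom n).2]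
      simp
  · rintro ⟨b, ⟨ν, hν, hmom⟩, hab⟩
    rw [support_subset_Ici_iff] at hν
    have hμ := hmap ν ξ fun n => (hmom n).1
    rw [show b = fun n => ∫ x, x ^ n ∂ν from funext fun n => (hmom n).2,
      xiShift_mk_integral fun n => (hmom n).1] at hab
    refine ⟨ν.map (· + ξ), ?_, fun n => ⟨(hμ n).1, ?_⟩⟩
    · rw [support_subset_Ici_iff, ae_map_iff (by fun_prop) measurableSet_Ici]
      filter_upwards [hν] with x hx
      linarith
    · rw [(hμ n).2]
      simpa using congrArg (coeff n) hab

/-- The sequence `e 0, o 0, e 1, o 1, …`. -/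
def interleave (e o : ℕ → ℝ) (n : ℕ) : ℝ :=
  if n % 2 = 0 then e (n / 2) else o (n / 2)

lemma interleave_even (e o : ℕ → ℝ) (k : ℕ) : interleave e o (2 * k) = e k := by
  simp [interleave]

lemma interleave_odd (e o : ℕ → ℝ) (k : ℕ) : interleave e o (2 * k + 1) = o k := by
  have h1 : (2 * k + 1) % 2 = 1 := by omega
  have h2 : (2 * k + 1) / 2 = k := by omega
  simp [interleave, h1, h2]

lemma interleave_even_succ (e o : ℕ → ℝ) (k : ℕ) : interleave e o (2 * k + 2) = e (k + 1) :=
  interleave_even e o (k + 1)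

lemma interleave_nonneg {e o : ℕ → ℝ} (he : ∀ k, 0 ≤ e k) (ho : ∀ k, 0 ≤ o k) (n : ℕ) :
    0 ≤ interleave e o n := by
  unfold interleave
  split_ifs
  exacts [he _, ho _]

lemma XiCoefficients.exists_zero_start {ξ : ℝ} (hξ : 0 ≤ ξ) {g α : ℕ → ℝ} (hg : ∀ i, 0 ≤ g i)
    (hα : XiCoefficients ξ g α) :
    ∃ g' : ℕ → ℝ, g' 0 = 0 ∧ (∀ i, 0 ≤ g' i) ∧ XiCoefficients ξ g' α := by
  let e : ℕ → ℝ := fun k => Nat.rec 0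
    (fun k x => α (2 * k + 2) * (1 + x) / (α (2 * k + 1) - ξ * (1 + x))) k
  let o : ℕ → ℝ := fun k => α (2 * k + 1) - ξ * (1 + e k)
  have he : ∀ k, e (k + 1) = α (2 * k + 2) * (1 + e k) / o k := fun k => rfl
  have ho : ∀ k, e k ≤ g (2 * k) → g (2 * k + 1) ≤ o k := by
    intro k hk
    have := mul_nonneg hξ (sub_nonneg.2 hk)
    simp only [o, (hα k).1]
    linarith
  have hbound : ∀ k, 0 ≤ e k ∧ e k ≤ g (2 * k) := by
    intro k
    induction k with
    | zero => exact ⟨le_rfl, hg _⟩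
    | succ k ih =>
      have h1 := ho k ih.2
      have hg0 := hg (2 * k)
      have hg1 := hg (2 * k + 1)
      have hg2 : 0 ≤ g (2 * k + 2) := hg _
      have ho0 := hg1.trans h1
      have hα2 : 0 ≤ α (2 * k + 2) := by
        rw [(hα k).2]
        positivity
      have he1 : 0 ≤ 1 + e k := by linarith [ih.1]
      rw [he]
      refine ⟨by positivity, ?_⟩
      refine div_le_of_le_mul₀ ho0 hg2 ?_
      rw [(hα k).2, div_mul_eq_mul_div]
      refine div_le_of_le_mul₀ (by linarith) (mul_nonneg hg2 ho0) ?_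
      calc g (2 * k + 1) * g (2 * k + 2) * (1 + e k)
          ≤ o k * g (2 * k + 2) * (1 + g (2 * k)) := by
            gcongr
            exact ih.2
        _ = _ := by rw [mul_comm (o k)]; rfl
  refine ⟨interleave e o, interleave_even e o 0,
    interleave_nonneg (fun k => (hbound k).1) fun k => (hg _).trans (ho k (hbound k).2),
    fun k => ⟨?_, ?_⟩⟩
  · rw [interleave_even, interleave_odd]
    simp [o]
  · rw [interleave_even, interleave_odd, interleave_even_succ, he]
    have h1 : 1 + e k ≠ 0 := by linarith [(hbound k).1]
    rcases eq_or_ne (o k) 0 with h | h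
    · have hg1 : g (2 * k + 1) = 0 := le_antisymm (h ▸ ho k (hbound k).2) (hg _)
      rw [(hα k).2, hg1, h]
      simp
    · field_simp

lemma exists_xiCoefficients_of_nonneg {ξ : ℝ} (hξ : 0 ≤ ξ) {β : ℕ → ℝ} (hβ : ∀ i, 0 ≤ β i)
    (hβ0 : ∀ i, β i = 0 → β (i + 1) = 0) :
    ∃ g α : ℕ → ℝ, g 0 = 0 ∧ (∀ i, 0 ≤ g i) ∧ XiCoefficients ξ g α ∧
      (∀ k, β (2 * k + 1) = g (2 * k + 1)) ∧
      ∀ k, β (2 * k + 2) = α (2 * k + 1) * g (2 * k + 2) / (1 + g (2 * k)) := by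
  let e : ℕ → ℝ := fun k => Nat.rec 0
    (fun k x => β (2 * k + 2) * (1 + x) / (ξ * (1 + x) + β (2 * k + 1))) k
  let o : ℕ → ℝ := fun k => β (2 * k + 1)
  have he : ∀ k, e (k + 1) = β (2 * k + 2) * (1 + e k) / (ξ * (1 + e k) + o k) := fun k => rfl
  have ho : ∀ k, 0 ≤ o k := fun k => hβ _
  have he0 : ∀ k, 0 ≤ e k := by
    intro k
    induction k with
    | zero => exact le_rfl
    | succ k ih =>
      rw [he]
      have := ho k
      have := hβ (2 * k + 2)
      positivity
  refine ⟨interleave e o, interleave (fun k => o (k - 1) * e k / (1 + e (k - 1)))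
    (fun k => ξ * (1 + e k) + o k), interleave_even e o 0, interleave_nonneg he0 ho,
    fun k => ⟨?_, ?_⟩, fun k => (interleave_odd e o k).symm, fun k => ?_⟩
  · simp only [interleave_even, interleave_odd]
  · simp only [interleave_even, interleave_odd, interleave_even_succ, Nat.add_sub_cancel]
  · simp only [interleave_odd, interleave_even, interleave_even_succ, he]
    have hk := he0 k
    have hpos : 0 ≤ ξ * (1 + e k) := by positivity
    rcases eq_or_ne (ξ * (1 + e k) + o k) 0 with h | h
    · have : o k = 0 := by linarith [ho k]
      rw [hβ0 _ this, h]
      simp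
    · have : 1 + e k ≠ 0 := by positivity
      field_simp

theorem theorem2 (ξ : ℝ) (hξ : 0 ≤ ξ) (a : ℕ → ℝ) :
    List.TFAE [
      IsXiStieltjes ξ a,
      ∃ (c : ℝ) (g α : ℕ → ℝ), 0 ≤ c ∧ g 0 = 0 ∧ (∀ i, 1 ≤ i → 0 ≤ g i) ∧
        XiCoefficients ξ g α ∧ IsSFraction (PowerSeries.mk a) c α,
      ∃ (c : ℝ) (g α : ℕ → ℝ), 0 ≤ c ∧ 0 ≤ g 0 ∧ (∀ i, 1 ≤ i → 0 ≤ g i) ∧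
        XiCoefficients ξ g α ∧ IsSFraction (PowerSeries.mk a) c α] := by
  tfae_have 1 → 2 := by
    rw [isXiStieltjes_iff]
    rintro ⟨b, hb, hab⟩
    obtain ⟨β, G, hβ, hβ0, hG, hbG⟩ := hb.isHankelPos.exists_sFraction
    obtain ⟨g, α, hg0, hg, hα, hodd, heven⟩ := exists_xiCoefficients_of_nonneg hξ hβ hβ0
    obtain ⟨F, hF⟩ := exists_isSTailFamily α
    refine ⟨β 0, g, α, hβ 0, hg0, fun i _ => hg i, hα, (hF.isSFraction_iff _ _).2 ?_⟩
    rw [hab, hbG, xiShift_C_mul,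
      hF.eq_xiShift_of_xiCoefficients hG hg0 (fun i _ => hg i) hα hodd heven]
  tfae_have 2 → 3 := by
    rintro ⟨c, g, α, hc, hg0, h⟩
    exact ⟨c, g, α, hc, hg0.ge, h⟩
  tfae_have 3 → 1 := by
    rintro ⟨c, g', α, hc, hg0', hg', hα', hf⟩
    obtain ⟨g, hg0, hg, hα⟩ := hα'.exists_zero_start hξ fun i => by
      rcases Nat.eq_zero_or_pos i with rfl | hi
      exacts [hg0', hg' i hi]
    obtain ⟨F, hF⟩ := exists_isSTailFamily α
    let β : ℕ → ℝ := interleave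
      (fun k => α (2 * (k - 1) + 1) * g (2 * (k - 1) + 2) / (1 + g (2 * (k - 1))))
      (fun k => g (2 * k + 1))
    obtain ⟨G, hG⟩ := exists_isSTailFamily β
    have hβ : ∀ i, 0 ≤ β i := by
      refine interleave_nonneg (fun k => ?_) fun k => hg _
      have h0 := hg (2 * (k - 1))
      have h1 := hg (2 * (k - 1) + 1)
      have h2 := hg (2 * (k - 1) + 2)
      rw [(hα _).1]
      positivity
    have hFG : F 1 = xiShift ξ (G 1) :=
      hF.eq_xiShift_of_xiCoefficients hG hg0 (fun i _ => hg i) hα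
        (fun k => interleave_odd _ _ k) fun k => interleave_even_succ _ _ k
    rw [hF.isSFraction_iff] at hf
    rw [isXiStieltjes_iff]
    refine ⟨_, hG.isXiStieltjes (fun i _ => hβ i) hc, ?_⟩
    rw [hf, hFG, ← xiShift_C_mul]
    congr 1
    ext n
    simp
  tfae_finish
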